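/- Let $n\ge 2$ be an integer and let $p\in\mathbb{C}[z]$ be a monic polynomial of degree $n$ all of whose zeros lie in the closed unit disk $\{|z|\le 1\}$. Let $a$ be a real number with $0<a<1$ and $p(a)=0$, and suppose that every critical point $\zeta$ of $p$ (that is, every zero of $p'$) satisfies $|a-\zeta|\ge 1$. Let $\lambda$ be a real number with $$1-(1-|p(0)|)^{1/n}\;\le\;\lambda\;\le\;\sin\!\left(\frac{\pi}{n}\right)\qquad\text{and}\qquad \lambda<a .$$ Then $p$ has a critical point $\zeta_0$ with $$\operatorname{Re}\zeta_0\;\ge\;\frac12\left(a-\frac{\lambda(\lambda+2)}{a}\right).$$ -/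

import Mathlib

/-! The plan is to find `b ≠ 0` near `a` with `p(b) = p(0)`. A critical point `ζ` then lies no
farther from `b` than from `0`, so `|ζ - a| ≤ |ζ| + λ`. Squaring and using `|ζ| ≤ 1` (Gauss–Lucas)
gives the bound on `Re ζ`.

To find `b`: since critical points stay at distance at least 1 from `a`, `|p(a + w)| ≥ 1 - (1 -
|w|)^n` for `|w| ≤ sin(π/n)`. The lower bound on `λ` says `|p(0)| ≤ 1 - (1 - λ)^n`, so `|p| ≥
|p(0)|` on the circle `|z - a| = λ`, and `p` takes the value `p(0)` inside it.

Both facts about critical points come from Grace–Walsh–Szegő coincidence applied to integrals of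
`p'`: all its zeros may be merged into one, and the integral becomes explicit. -/

/-! ### Laguerre's theorem and Grace–Walsh–Szegő coincidence. -/

open Polynomial in
/-- The polynomial `t ↦ L ((A - t B) ^ m)` and its derivative. -/
theorem exists_polynomial_eval_eq_apply_sub_smul_pow {R : Type*} [CommRing R] [Algebra ℂ R]
    (A B : R) (m : ℕ) (L : R →ₗ[ℂ] ℂ) :
    ∃ f : ℂ[X], f.natDegree ≤ m ∧ (∀ t : ℂ, f.eval t = L ((A - t • B) ^ m)) ∧
      ∀ t : ℂ, (derivative f).eval t = -(m * L (B * (A - t • B) ^ (m - 1))) := by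
  induction m generalizing L with
  | zero => exact ⟨C (L 1), by simp, by simp, by simp⟩
  | succ m ih =>
    obtain ⟨f, hf, hfe, hfd⟩ := ih (L ∘ₗ LinearMap.mulLeft ℂ A)
    obtain ⟨g, hg, hge, hgd⟩ := ih (L ∘ₗ LinearMap.mulLeft ℂ B)
    refine ⟨f - X * g, ?_, fun t => ?_, fun t => ?_⟩
    · refine (natDegree_sub_le _ _).trans (max_le (by omega) ?_)
      exact natDegree_mul_le.trans (by rw [natDegree_X]; omega)
    · have : (A - t • B) ^ (m + 1) = A * (A - t • B) ^ m - t • (B * (A - t • B) ^ m) := by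
        rw [pow_succ', sub_mul, smul_mul_assoc]
      simp [hfe, hge, this]
    · simp only [derivative_sub, derivative_mul, derivative_X, eval_sub, eval_add, eval_mul,
        eval_X, eval_one, hfd, hge, hgd, LinearMap.comp_apply, LinearMap.mulLeft_apply]
      rcases m with _ | m
      · simp
      · have : B * (A - t • B) ^ (m + 1) =
            A * (B * (A - t • B) ^ m) - t • (B * (B * (A - t • B) ^ m)) := by
          rw [pow_succ', sub_mul, mul_sub, smul_mul_assoc, mul_smul_comm]
          congr 1
          · ring
        simp only [add_tsub_cancel_right, this, map_sub, map_smul, smul_eq_mul]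
        push_cast
        ring

theorem Convex.exists_sum_eq_card_smul {K : Set ℂ} (hK : Convex ℝ K) (h0 : (0 : ℂ) ∈ K)
    (s : Multiset ℂ) (hs : ∀ u ∈ s, u ∈ K) : ∃ k ∈ K, s.sum = (s.card : ℝ) • k := by
  induction s using Multiset.induction with
  | empty => exact ⟨0, h0, by simp⟩
  | cons u s ih =>
    obtain ⟨k, hk, hsum⟩ := ih fun v hv => hs v (Multiset.mem_cons_of_mem hv)
    have hu := hs u (Multiset.mem_cons_self u s)
    have hc : (0 : ℝ) < s.card + 1 := by positivity
    refine ⟨(1 / (s.card + 1 : ℝ)) • u + (s.card / (s.card + 1 : ℝ)) • k,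
      hK hu hk (by positivity) (by positivity) (by field_simp; ring), ?_⟩
    rw [Multiset.sum_cons, hsum, Multiset.card_cons, smul_add, smul_smul, smul_smul]
    push_cast
    rw [mul_one_div_cancel hc.ne', mul_div_cancel₀ _ hc.ne', one_smul]

open Polynomial in
/-- Laguerre's theorem on polar derivatives, for a region whose complement is sent to a convex set
by every inversion centred in the region. -/
theorem Polynomial.polarDerivative_ne_zero {C : Set ℂ}
    (hC : ∀ z ∈ C, Convex ℝ {u : ℂ | u = 0 ∨ z - u⁻¹ ∉ C}) {f : ℂ[X]} {m : ℕ} (hm : m ≠ 0)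
    (hdeg : f.natDegree ≤ m) (hf : ∀ z ∈ C, f.eval z ≠ 0) {z w : ℂ} (hz : z ∈ C) (hw : w ∈ C) :
    m * f.eval z + (w - z) * (derivative f).eval z ≠ 0 := by
  intro h
  have hfz := hf z hz
  have hm' : (m : ℂ) ≠ 0 := by exact_mod_cast hm
  have hwz : z - w ≠ 0 := by
    intro h0
    have : w - z = 0 := by linear_combination -h0
    rw [this, zero_mul, add_zero] at h
    exact mul_ne_zero hm' hfz h
  have hlog := (IsAlgClosed.splits f).eval_derivative_div_eval_of_ne_zero hfz
  obtain ⟨k, hk, hsum⟩ := (hC z hz).exists_sum_eq_card_smul (Or.inl rfl)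
    (f.roots.map fun r => 1 / (z - r)) (by
      intro u hu
      obtain ⟨r, hr, rfl⟩ := Multiset.mem_map.1 hu
      right
      simp only [one_div, inv_inv, sub_sub_cancel]
      exact fun hrC => hf r hrC (isRoot_of_mem_roots hr))
  have hcard : (f.roots.card : ℝ) ≤ m := by exact_mod_cast (card_roots' f).trans hdeg
  have hmpos : (0 : ℝ) < m := by exact_mod_cast Nat.pos_of_ne_zero hm
  -- The `m - deg f` missing roots count as roots at infinity, contributing `0` to the average.
  have hmem := (hC z hz).smul_mem_of_zero_mem (Or.inl rfl) hk
    (t := (f.roots.card : ℝ) / m) ⟨by positivity, by rwa [div_le_one hmpos]⟩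
  have hval : ((f.roots.card : ℝ) / m) • k = (z - w)⁻¹ := by
    rw [hsum, Multiset.card_map] at hlog
    rw [Complex.real_smul] at hlog ⊢
    have h1 : (derivative f).eval z / f.eval z = m / (z - w) := by
      rw [div_eq_div_iff hfz hwz]
      linear_combination -h
    push_cast
    rw [h1] at hlog
    push_cast at hlog
    field_simp
    rw [← hlog]
    field_simp
  rw [hval] at hmem
  rcases hmem with h0 | h0
  · exact inv_ne_zero hwz h0
  · rw [inv_inv, sub_sub_cancel] at h0
    exact h0 hw

/-- The Grace–Walsh–Szegő coincidence theorem, for a linear functional applied to a product of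
linear forms. -/
theorem LinearMap.apply_prod_sub_smul_ne_zero {R : Type*} [CommRing R] [Algebra ℂ R] (A B : R)
    {C : Set ℂ} (hne : C.Nonempty)
    (hC : ∀ z ∈ C, Convex ℝ {u : ℂ | u = 0 ∨ z - u⁻¹ ∉ C}) (s : Multiset ℂ) (hs : ∀ t ∈ s, t ∈ C) (L : R →ₗ[ℂ] ℂ)
    (hL : ∀ t ∈ C, L ((A - t • B) ^ s.card) ≠ 0) :
    L (s.map fun t => A - t • B).prod ≠ 0 := by
  induction s using Multiset.induction generalizing L with
  | empty =>
    obtain ⟨t, ht⟩ := hne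
    simpa using hL t ht
  | cons w s ih =>
    have hw := hs w (Multiset.mem_cons_self w s)
    rw [Multiset.map_cons, Multiset.prod_cons]
    -- Absorb one factor into the functional; its value on `(A - tB)^k` is then, up to a nonzero
    -- scalar, a polar derivative with pole `w`.
    refine ih (fun v hv => hs v (Multiset.mem_cons_of_mem hv))
      (L ∘ₗ LinearMap.mulLeft ℂ (A - w • B)) fun t ht => ?_
    rw [Multiset.card_cons] at hL
    obtain ⟨f, hf, hfe, hfd⟩ := exists_polynomial_eval_eq_apply_sub_smul_pow A B (s.card + 1) L
    have hpolar := Polynomial.polarDerivative_ne_zero hC (Nat.succ_ne_zero s.card) hf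
      (fun z hz => by rw [hfe]; exact hL z hz) ht hw
    intro h0
    apply hpolar
    have hsplit : (A - w • B) * (A - t • B) ^ s.card =
        (A - t • B) ^ (s.card + 1) - (w - t) • (B * (A - t • B) ^ s.card) := by
      rw [pow_succ', sub_mul, sub_mul, sub_smul, smul_mul_assoc, smul_mul_assoc]
      abel
    simp only [LinearMap.comp_apply, LinearMap.mulLeft_apply, hsplit, map_sub, map_smul,
      smul_eq_mul] at h0
    rw [hfe, hfd, Nat.add_sub_cancel]
    linear_combination ((s.card + 1 : ℕ) : ℂ) * h0

/-! ### Inversions of discs and half planes. -/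

/-- Clearing `u⁻¹` and squaring turns each inverted complement below into a sublevel set of such a
quadratic; `c ≥ 0` because the centre of inversion lies in the region. -/
theorem Complex.convexOn_mul_norm_sq_add_re {c : ℝ} (hc : 0 ≤ c) (v : ℂ) :
    ConvexOn ℝ Set.univ fun u : ℂ => c * ‖u‖ ^ 2 + 2 * (v * u).re := by
  have h1 : ConvexOn ℝ Set.univ fun u : ℂ => ‖u‖ ^ 2 :=
    (convexOn_norm convex_univ).pow (fun _ _ => norm_nonneg _) 2
  have h2 : ConvexOn ℝ Set.univ fun u : ℂ => 2 * (v * u).re := by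
    refine ⟨convex_univ, fun x _ y _ a b _ _ _ => le_of_eq ?_⟩
    simp
    ring
  exact (h1.smul hc).add h2

theorem Complex.norm_sq_eq_re_im (z : ℂ) : ‖z‖ ^ 2 = z.re ^ 2 + z.im ^ 2 := by
  rw [Complex.sq_norm, Complex.normSq_apply]; ring

theorem Complex.convex_inversion_compl_closedBall {z : ℂ} (hz : z ∈ Metric.closedBall (0 : ℂ) 1) :
    Convex ℝ {u : ℂ | u = 0 ∨ z - u⁻¹ ∉ Metric.closedBall (0 : ℂ) 1} := by
  rw [mem_closedBall_zero_iff] at hz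
  have hc : 0 ≤ 1 - ‖z‖ ^ 2 := by nlinarith [norm_nonneg z]
  refine Eq.subst (motive := Convex ℝ) ?_
    ((Complex.convexOn_mul_norm_sq_add_re hc z).convex_lt 1)
  ext u
  rw [iff_comm]
  simp only [Set.mem_ofPred_eq, Set.mem_univ, true_and, mem_closedBall_zero_iff, not_le]
  have key : (1 - ‖z‖ ^ 2) * ‖u‖ ^ 2 + 2 * (z * u).re < 1 ↔ ‖u‖ < ‖z * u - 1‖ := by
    rw [← sq_lt_sq₀ (norm_nonneg u) (norm_nonneg _)]
    simp only [Complex.norm_sq_eq_re_im, Complex.sub_re, Complex.sub_im, Complex.mul_re,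
      Complex.mul_im, Complex.one_re, Complex.one_im]
    constructor <;> intro h <;> linarith
  rw [key]
  by_cases hu : u = 0
  · simp [hu]
  · have h1 : z * u - 1 = (z - u⁻¹) * u := by field_simp
    rw [h1, norm_mul, lt_mul_iff_one_lt_left (norm_pos_iff.2 hu)]
    simp [hu]

theorem Complex.convex_inversion_compl_bisector {b z : ℂ} (hz : z ∈ {ζ : ℂ | ‖ζ‖ < ‖ζ - b‖}) :
    Convex ℝ {u : ℂ | u = 0 ∨ z - u⁻¹ ∉ {ζ : ℂ | ‖ζ‖ < ‖ζ - b‖}} := by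
  rw [Set.mem_ofPred_eq] at hz
  have hc : 0 ≤ ‖z - b‖ ^ 2 - ‖z‖ ^ 2 := by nlinarith [norm_nonneg z, norm_nonneg (z - b)]
  convert (Complex.convexOn_mul_norm_sq_add_re hc b).convex_le 0 using 1
  ext u
  simp only [Set.mem_ofPred_eq, Set.mem_univ, true_and, not_lt]
  have key : (‖z - b‖ ^ 2 - ‖z‖ ^ 2) * ‖u‖ ^ 2 + 2 * (b * u).re ≤ 0 ↔
      ‖(z - b) * u - 1‖ ≤ ‖z * u - 1‖ := by
    rw [← sq_le_sq₀ (norm_nonneg _) (norm_nonneg _)]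
    simp only [Complex.norm_sq_eq_re_im, Complex.sub_re, Complex.sub_im, Complex.mul_re,
      Complex.mul_im, Complex.one_re, Complex.one_im]
    constructor <;> intro h <;> linarith
  rw [key]
  by_cases hu : u = 0
  · simp [hu]
  · have h1 : z * u - 1 = (z - u⁻¹) * u := by field_simp
    have h2 : (z - b) * u - 1 = (z - u⁻¹ - b) * u := by field_simp; ring
    rw [h1, h2, norm_mul, norm_mul, mul_le_mul_iff_left₀ (norm_pos_iff.2 hu)]
    simp [hu]

/-! ### Integrals of `p'` and the bisector theorem. -/

namespace Polynomial

/-- The linear functional `q ↦ ∫₀ʷ q`. -/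
noncomputable def integralTo (w : ℂ) : ℂ[X] →ₗ[ℂ] ℂ :=
  lsum fun k => (w ^ (k + 1) / (k + 1 : ℂ)) • LinearMap.id

theorem integralTo_derivative (w : ℂ) (P : ℂ[X]) :
    integralTo w (derivative P) = P.eval w - P.eval 0 := by
  induction P using Polynomial.induction_on' with
  | add p q hp hq => simp only [map_add, hp, hq, eval_add]; ring
  | monomial k c =>
    rcases k with _ | k
    · simp
    · have hk : (k + 1 : ℂ) ≠ 0 := by exact_mod_cast Nat.succ_ne_zero k
      rw [derivative_monomial]
      simp [integralTo, lsum_apply, sum_monomial_index]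
      field_simp

theorem derivative_eq_prod_roots {p : ℂ[X]} (hmonic : p.Monic) :
    derivative p = C (p.natDegree : ℂ) *
      ((derivative p).roots.map fun ζ => X - C ζ).prod := by
  conv_lhs => rw [(IsAlgClosed.splits (derivative p)).eq_prod_roots]
  rw [leadingCoeff_derivative, hmonic.leadingCoeff, one_mul]

theorem card_roots_derivative (p : ℂ[X]) :
    (derivative p).roots.card = p.natDegree - 1 := by
  rw [← (IsAlgClosed.splits (derivative p)).natDegree_eq_card_roots, natDegree_derivative]

/-- If `p` takes the same value at two points, each closed half plane bounded by their
perpendicular bisector contains a critical point. -/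
theorem exists_derivative_isRoot_norm_sub_le {p : ℂ[X]} (hmonic : p.Monic) {b : ℂ} (hb : b ≠ 0)
    (hpb : p.eval b = p.eval 0) :
    ∃ ζ, (derivative p).IsRoot ζ ∧ ‖ζ - b‖ ≤ ‖ζ‖ := by
  by_contra! hcon
  have hroot : ∀ ζ ∈ (derivative p).roots, ζ ∈ {ζ : ℂ | ‖ζ‖ < ‖ζ - b‖} :=
    fun ζ hζ => hcon ζ (isRoot_of_mem_roots hζ)
  have hn : (p.natDegree : ℂ) ≠ 0 := by
    intro h0
    have h0' : p.natDegree = 0 := by exact_mod_cast h0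
    have h1 := hmonic.natDegree_eq_zero.1 h0'
    have := hcon b (by simp [h1])
    simp only [sub_self, norm_zero] at this
    exact absurd this (norm_nonneg b).not_gt
  have hprod := LinearMap.apply_prod_sub_smul_ne_zero (X : ℂ[X]) 1
    (C := {ζ : ℂ | ‖ζ‖ < ‖ζ - b‖}) ⟨0, by simpa using hb⟩
    (fun z hz => Complex.convex_inversion_compl_bisector hz) _ hroot (integralTo b) (by
      intro t ht h0
      set m := (derivative p).roots.card
      have hd : derivative ((X - t • (1 : ℂ[X])) ^ (m + 1)) =
          ((m + 1 : ℕ) : ℂ) • (X - t • (1 : ℂ[X])) ^ m := by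
        rw [derivative_pow_succ]
        simp [smul_eq_C_mul]
      have hi := integralTo_derivative b ((X - t • (1 : ℂ[X])) ^ (m + 1))
      rw [hd, map_smul, h0, smul_zero] at hi
      simp only [eval_pow, eval_sub, eval_X, eval_smul, eval_one, smul_eq_mul, mul_one,
        zero_sub] at hi
      -- A vanishing integral of `(x - t)^m` puts `t` on the bisector, outside the open half plane.
      have heq : ‖b - t‖ ^ (m + 1) = ‖t‖ ^ (m + 1) := by
        rw [← norm_pow, ← norm_neg t, ← norm_pow, ← sub_eq_zero.1 hi.symm]
      have hlt := pow_lt_pow_left₀ ht (norm_nonneg t) (Nat.succ_ne_zero m)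
      rw [norm_sub_rev, heq] at hlt
      exact hlt.false)
  apply hprod
  have hi := integralTo_derivative b p
  rw [derivative_eq_prod_roots hmonic, hpb, sub_self, ← smul_eq_C_mul, map_smul, smul_eq_mul] at hi
  have h0 := (mul_eq_zero.1 hi).resolve_left hn
  simpa [smul_eq_C_mul] using h0

end Polynomial

/-! ### Lower bound for `|1 - (1 - u)^n|`. -/

/-- Compare derivatives along `t ↦ tx`: `|1 - tx| ≥ 1 - t|x|` and the exponent `α - 1` is
nonpositive. -/
theorem Complex.norm_one_sub_one_sub_cpow_le {x : ℂ} (hx : ‖x‖ < 1) {α : ℝ} (h0 : 0 ≤ α)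
    (h1 : α ≤ 1) : ‖1 - (1 - x) ^ (α : ℂ)‖ ≤ 1 - (1 - ‖x‖) ^ α := by
  have hpos : ∀ t ∈ Set.Icc (0 : ℝ) 1, 0 < 1 - t * ‖x‖ := fun t ht => by
    nlinarith [ht.1, ht.2, norm_nonneg x]
  have hre : ∀ t ∈ Set.Icc (0 : ℝ) 1, 1 - t * ‖x‖ ≤ (1 - (t : ℂ) * x).re := fun t ht => by
    have := Complex.re_le_norm x
    simp only [Complex.sub_re, Complex.one_re, Complex.re_ofReal_mul]
    nlinarith [ht.1]
  have hf : ∀ t ∈ Set.Icc (0 : ℝ) 1, HasDerivAt (fun t : ℝ => 1 - (1 - (t : ℂ) * x) ^ (α : ℂ))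
      (-(α * (1 - (t : ℂ) * x) ^ ((α : ℂ) - 1) * -(1 * x))) t := fun t ht => by
    have hlin : HasDerivAt (fun t : ℝ => 1 - (t : ℂ) * x) (-(1 * x)) t :=
      ((Complex.ofRealCLM.hasDerivAt (x := t)).mul_const x).const_sub 1
    have hs : 1 - (t : ℂ) * x ∈ Complex.slitPlane := Or.inl ((hpos t ht).trans_le (hre t ht))
    have := ((hasDerivAt_id (1 - (t : ℂ) * x)).cpow_const (c := (α : ℂ)) hs).comp t hlin
    exact (this.const_sub 1).congr_deriv (by simp)
  have hB : ∀ t ∈ Set.Icc (0 : ℝ) 1, HasDerivAt (fun t : ℝ => 1 - (1 - t * ‖x‖) ^ α)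
      (-(-(1 * ‖x‖) * α * (1 - t * ‖x‖) ^ (α - 1))) t := fun t ht =>
    ((((hasDerivAt_id t).mul_const ‖x‖).const_sub 1).rpow_const
      (Or.inl (hpos t ht).ne')).const_sub 1
  have := image_norm_le_of_norm_deriv_right_le_deriv_boundary'
    (fun t ht => (hf t ht).continuousAt.continuousWithinAt)
    (fun t ht => (hf t (Set.Ico_subset_Icc_self ht)).hasDerivWithinAt) (by simp)
    (fun t ht => (hB t ht).continuousAt.continuousWithinAt)
    (fun t ht => (hB t (Set.Ico_subset_Icc_self ht)).hasDerivWithinAt)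
    (fun t ht => by
      have ht' := Set.Ico_subset_Icc_self ht
      have hle : ‖(1 - (t : ℂ) * x) ^ ((α : ℂ) - 1)‖ ≤ (1 - t * ‖x‖) ^ (α - 1) := by
        have : (α : ℂ) - 1 = ((α - 1 : ℝ) : ℂ) := by push_cast; rfl
        rw [this, Complex.norm_cpow_real]
        exact Real.rpow_le_rpow_of_nonpos (hpos t ht')
          ((hre t ht').trans (Complex.re_le_norm _)) (by linarith)
      have hn : ‖-((α : ℂ) * (1 - (t : ℂ) * x) ^ ((α : ℂ) - 1) * -(1 * x))‖ =
          α * ‖x‖ * ‖(1 - (t : ℂ) * x) ^ ((α : ℂ) - 1)‖ := by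
        rw [norm_neg, norm_mul, norm_mul, norm_neg, one_mul, Complex.norm_real,
          Real.norm_of_nonneg h0]
        ring
      rw [hn]
      calc _ ≤ α * ‖x‖ * (1 - t * ‖x‖) ^ (α - 1) := by gcongr
        _ = _ := by ring)
    (Set.right_mem_Icc.2 zero_le_one)
  simpa using this

/-- The tangents from `0` to the circle of radius `sin θ` about `1` make angle `θ` with the real
axis. -/
theorem Complex.abs_arg_le_of_norm_one_sub_le_sin {z : ℂ} {θ : ℝ} (h0 : 0 ≤ θ)
    (h1 : θ ≤ Real.pi / 2) (hz : ‖1 - z‖ ≤ Real.sin θ) : |z.arg| ≤ θ := by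
  rcases eq_or_ne z 0 with rfl | hz0
  · simpa using h0
  have hs1 := Real.sin_le_one θ
  have hs0 := (norm_nonneg _).trans hz
  have hsq : (1 - z.re) ^ 2 + z.im ^ 2 ≤ Real.sin θ ^ 2 := by
    have := Complex.norm_sq_eq_re_im (1 - z)
    simp only [Complex.sub_re, Complex.sub_im, Complex.one_re, Complex.one_im, zero_sub,
      neg_sq] at this
    rw [← this]
    gcongr
  have hre : 0 ≤ z.re := by nlinarith [sq_nonneg z.im]
  have him : |z.im| ≤ Real.sin θ * ‖z‖ := by
    refine abs_le_of_sq_le_sq ?_ (by positivity)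
    rw [mul_pow, Complex.norm_sq_eq_re_im]
    -- Equality holds at the tangency points, whose real part is `1 - sin² θ`.
    nlinarith [sq_nonneg (z.re - (1 - Real.sin θ ^ 2)),
      mul_nonneg (sub_nonneg.2 hsq) (show 0 ≤ 1 - Real.sin θ ^ 2 by nlinarith)]
  have hdiv : |z.im / ‖z‖| ≤ Real.sin θ := by
    rw [abs_div, abs_norm, div_le_iff₀ (norm_pos_iff.2 hz0)]
    exact him
  rw [Complex.arg_of_re_nonneg hre]
  obtain ⟨hl, hr⟩ := abs_le.1 hdiv
  have hm : z.im / ‖z‖ ∈ Set.Icc (-1 : ℝ) 1 := ⟨by linarith, by linarith⟩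
  refine abs_le.2 ⟨?_, (Real.arcsin_le_iff_le_sin hm ⟨by linarith, h1⟩).2 hr⟩
  refine (Real.le_arcsin_iff_sin_le ⟨by linarith, by linarith⟩ hm).2 ?_
  rwa [Real.sin_neg]

theorem Complex.one_le_norm_one_sub_pow_of_abs_arg_eq {z : ℂ} {n : ℕ} (hn : n ≠ 0)
    (hz : |z.arg| = Real.pi / n) : 1 ≤ ‖1 - z ^ n‖ := by
  have hn' : (n : ℂ) ≠ 0 := by exact_mod_cast hn
  have hpow : z ^ n = ((-‖z‖ ^ n : ℝ) : ℂ) := by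
    conv_lhs => rw [← Complex.norm_mul_exp_arg_mul_I z, mul_pow, ← Complex.exp_nat_mul]
    rcases abs_choice z.arg with h | h
    · rw [← h, hz]
      have : (n : ℂ) * (((Real.pi / n : ℝ) : ℂ) * Complex.I) = Real.pi * Complex.I := by
        push_cast; field_simp
      rw [this, Complex.exp_pi_mul_I]; push_cast; ring
    · rw [show z.arg = -(Real.pi / n) by linarith]
      have : (n : ℂ) * (((-(Real.pi / n) : ℝ) : ℂ) * Complex.I) = -(Real.pi * Complex.I) := by
        push_cast; field_simp
      rw [this, Complex.exp_neg, Complex.exp_pi_mul_I]; push_cast; norm_num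
  have hp : 0 ≤ ‖z‖ ^ n := by positivity
  rw [hpow, ← Complex.ofReal_one, ← Complex.ofReal_sub, Complex.norm_real, Real.norm_eq_abs]
  exact le_abs.2 (Or.inl (by linarith))

/-- When the right side is below 1, `1 - u` lies strictly inside the sector `|arg| < π/n`, so it is
the principal `n`-th root of its power and the `cpow` estimate with `α = 1/n` can be inverted. -/
theorem Complex.one_sub_one_sub_norm_pow_le {u : ℂ} {n : ℕ} (hn : 2 ≤ n)
    (hu : ‖u‖ ≤ Real.sin (Real.pi / n)) : 1 - (1 - ‖u‖) ^ n ≤ ‖1 - (1 - u) ^ n‖ := by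
  have hn0 : n ≠ 0 := by omega
  have hn2 : (2 : ℝ) ≤ n := by exact_mod_cast hn
  have hu1 : ‖u‖ ≤ 1 := hu.trans (Real.sin_le_one _)
  rcases le_or_gt 1 ‖1 - (1 - u) ^ n‖ with h | h
  · have : 0 ≤ (1 - ‖u‖) ^ n := pow_nonneg (by linarith) n
    linarith
  have harg : |(1 - u).arg| ≤ Real.pi / n :=
    Complex.abs_arg_le_of_norm_one_sub_le_sin (by positivity)
      (div_le_div_of_nonneg_left Real.pi_pos.le two_pos hn2) (by simpa using hu)
  have hlt : |(1 - u).arg| < Real.pi / n := harg.lt_of_ne fun heq =>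
    (Complex.one_le_norm_one_sub_pow_of_abs_arg_eq hn0 heq).not_gt h
  obtain ⟨hl, hr⟩ := abs_lt.1 hlt
  have hroot := Complex.pow_cpow_nat_inv hn0 hl hr.le
  have hle := Complex.norm_one_sub_one_sub_cpow_le h (α := (n : ℝ)⁻¹) (by positivity)
    (inv_le_one_of_one_le₀ (by linarith))
  push_cast at hle
  rw [sub_sub_cancel, hroot, sub_sub_cancel] at hle
  set s := ‖1 - (1 - u) ^ n‖
  have hpow := pow_le_pow_left₀ (by positivity : 0 ≤ (1 - s) ^ ((n : ℝ)⁻¹))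
    (show (1 - s) ^ ((n : ℝ)⁻¹) ≤ 1 - ‖u‖ by linarith) n
  rw [Real.rpow_inv_natCast_pow (by linarith) hn0] at hpow
  linarith

/-- `(1 - (1 - r)^n) / r` is a geometric sum, decreasing in `r`. -/
theorem one_sub_one_sub_pow_mul_le {r t : ℝ} (hr1 : r ≤ 1) (ht0 : 0 ≤ t)
    (ht1 : t ≤ 1) (hr0 : 0 ≤ r) (n : ℕ) :
    t * (1 - (1 - r) ^ n) ≤ 1 - (1 - t * r) ^ n := by
  have h1 := mul_geom_sum (1 - r) n
  have h2 := mul_geom_sum (1 - t * r) n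
  have hle : ∑ i ∈ Finset.range n, (1 - r) ^ i ≤ ∑ i ∈ Finset.range n, (1 - t * r) ^ i :=
    Finset.sum_le_sum fun i _ => pow_le_pow_left₀ (by linarith) (by nlinarith) i
  have := mul_le_mul_of_nonneg_left hle (mul_nonneg ht0 hr0)
  linear_combination this + t * h1 - h2

theorem one_le_norm_multiset_prod {s : Multiset ℂ} (hs : ∀ z ∈ s, 1 ≤ ‖z‖) : 1 ≤ ‖s.prod‖ := by
  induction s using Multiset.induction with
  | empty => simp
  | cons z s ih =>
    rw [Multiset.prod_cons, norm_mul]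
    exact one_le_mul_of_one_le_of_one_le (hs z (Multiset.mem_cons_self z s))
      (ih fun w hw => hs w (Multiset.mem_cons_of_mem hw))

theorem norm_multiset_prod_le_one {s : Multiset ℂ} (hs : ∀ z ∈ s, ‖z‖ ≤ 1) : ‖s.prod‖ ≤ 1 := by
  induction s using Multiset.induction with
  | empty => simp
  | cons z s ih =>
    rw [Multiset.prod_cons, norm_mul]
    exact mul_le_one₀ (hs z (Multiset.mem_cons_self z s)) (norm_nonneg _)
      (ih fun w hw => hs w (Multiset.mem_cons_of_mem hw))

/-! ### Growth of `p` near `a` and the values it takes there. -/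

namespace Polynomial

/-- If `p` has no critical point in the open unit disc about its zero `a`, then `p` is bounded
below near `a`. -/
theorem one_sub_one_sub_norm_pow_le_norm_eval {p : ℂ[X]} (hmonic : p.Monic)
    (hn : 2 ≤ p.natDegree) {a : ℂ} (hpa : p.IsRoot a)
    (hcrit : ∀ ζ, (derivative p).IsRoot ζ → 1 ≤ ‖a - ζ‖) {w : ℂ}
    (hw : ‖w‖ ≤ Real.sin (Real.pi / p.natDegree)) :
    1 - (1 - ‖w‖) ^ p.natDegree ≤ ‖p.eval (a + w)‖ := by
  set n := p.natDegree with hndef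
  set Z := (derivative p).roots with hZ
  have hcard : Z.card = n - 1 := card_roots_derivative p
  have hZ1 : ∀ ζ ∈ Z, 1 ≤ ‖a - ζ‖ := fun ζ hζ => hcrit ζ (isRoot_of_mem_roots hζ)
  have hn0 : (n : ℂ) ≠ 0 := by exact_mod_cast (show n ≠ 0 by omega)
  have hw1 : ‖w‖ ≤ 1 := hw.trans (Real.sin_le_one _)
  set T := Z.map fun ζ => (ζ - a)⁻¹ with hT
  set Q : ℂ[X] := (T.map fun t => 1 - t • X).prod with hQ
  set c := integralTo w Q with hc
  have hfac : derivative (p.comp (X + C a)) = (n * (Z.map fun ζ => a - ζ).prod) • Q := by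
    rw [derivative_comp, derivative_eq_prod_roots hmonic, ← hZ, hQ, hT, Multiset.map_map,
      mul_smul, smul_eq_C_mul, smul_eq_C_mul, ← Multiset.prod_hom _ (C : ℂ →+* ℂ[X]),
      Multiset.map_map, ← Multiset.prod_map_mul]
    simp only [derivative_add, derivative_X, derivative_C, add_zero, one_mul, mul_comp, C_comp,
      multiset_prod_comp, Multiset.map_map]
    congr 2
    refine Multiset.map_congr rfl fun ζ hζ => ?_
    have hne : ζ - a ≠ 0 := by
      intro h0
      have := hZ1 ζ hζ
      rw [norm_sub_rev, h0, norm_zero] at this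
      linarith
    have hinv : (a - ζ) * (ζ - a)⁻¹ = -1 := by
      rw [← neg_sub, neg_mul, mul_inv_cancel₀ hne]
    simp only [Function.comp_apply, sub_comp, X_comp, C_comp, smul_eq_C_mul]
    have : C (a - ζ) * (C (ζ - a)⁻¹ * X) = -X := by
      rw [← mul_assoc, ← C_mul, hinv]; simp
    rw [mul_sub, this, C_sub]
    ring
  have hval : p.eval (a + w) = n * (Z.map fun ζ => a - ζ).prod * c := by
    have := integralTo_derivative w (p.comp (X + C a))
    rw [hfac, map_smul, smul_eq_mul] at this
    simp only [eval_comp, eval_add, eval_X, eval_C, zero_add] at this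
    rw [hpa.eq_zero, sub_zero, add_comm w a] at this
    exact this.symm
  have hprod : 1 ≤ ‖(Z.map fun ζ => a - ζ).prod‖ := by
    refine one_le_norm_multiset_prod fun x hx => ?_
    obtain ⟨ζ, hζ, rfl⟩ := Multiset.mem_map.1 hx
    exact hZ1 ζ hζ
  have hbound : 1 - (1 - ‖w‖) ^ n ≤ n * ‖c‖ := by
    obtain ⟨t, ht, hLt⟩ : ∃ t ∈ Metric.closedBall (0 : ℂ) 1,
        integralTo w ((1 - t • (X : ℂ[X])) ^ T.card) = c := by
      by_contra! hcon
      refine LinearMap.apply_prod_sub_smul_ne_zero (1 : ℂ[X]) X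
        (C := Metric.closedBall (0 : ℂ) 1) ⟨0, by simp⟩
        (fun z hz => Complex.convex_inversion_compl_closedBall hz) T (fun t ht => ?_)
        -- Evaluation at `0` is 1 on every product of factors `1 - tX`, so this functional vanishes
        -- on one exactly when its integral is `c`.
        (integralTo w - c • leval 0) (fun t ht => ?_) ?_
      · obtain ⟨ζ, hζ, rfl⟩ := Multiset.mem_map.1 ht
        rw [mem_closedBall_zero_iff, norm_inv, norm_sub_rev]
        exact inv_le_one_of_one_le₀ (hZ1 ζ hζ)
      · simpa [leval_apply, sub_eq_zero] using hcon t ht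
      · have h1 : Q.eval 0 = 1 := by
          rw [hQ, eval_multiset_prod, Multiset.map_map]
          simp
        rw [← hQ]
        simp [leval_apply, h1, hc]
    rw [hT, Multiset.card_map, hcard] at hLt
    rw [mem_closedBall_zero_iff] at ht
    have hmain : n * t * c = 1 - (1 - t * w) ^ n := by
      have hd : derivative ((1 - t • (X : ℂ[X])) ^ n) =
          (-(n * t)) • (1 - t • (X : ℂ[X])) ^ (n - 1) := by
        rw [derivative_pow]
        simp [smul_eq_C_mul]
        ring
      have hi := integralTo_derivative w ((1 - t • (X : ℂ[X])) ^ n)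
      rw [hd, map_smul, hLt] at hi
      simp only [eval_pow, eval_sub, eval_X, eval_smul, eval_one, smul_eq_mul, mul_zero,
        sub_zero, one_pow] at hi
      linear_combination -hi
    rcases eq_or_ne t 0 with rfl | ht0
    · have hcw : c = w := by
        have := integralTo_derivative w X
        rw [derivative_X, eval_X, eval_X, sub_zero] at this
        simpa [this] using hLt.symm
      rw [hcw]
      -- With `t = 0` the bound is Bernoulli's inequality.
      have := one_add_mul_le_pow (a := -‖w‖) (by linarith) n
      rw [← sub_eq_add_neg] at this
      linarith
    · have htpos := norm_pos_iff.2 ht0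
      have htw : ‖t * w‖ ≤ ‖w‖ := by
        rw [norm_mul]; exact mul_le_of_le_one_left (norm_nonneg w) ht
      have h1 := Complex.one_sub_one_sub_norm_pow_le hn (htw.trans hw)
      have h2 := one_sub_one_sub_pow_mul_le hw1 (norm_nonneg t) ht (norm_nonneg w) n
      rw [← hmain, norm_mul, norm_mul, norm_mul, Complex.norm_natCast] at h1
      have h3 : ‖t‖ * (1 - (1 - ‖w‖) ^ n) ≤ ‖t‖ * (n * ‖c‖) := by linarith
      exact le_of_mul_le_mul_left h3 htpos
  rw [hval, norm_mul, norm_mul, Complex.norm_natCast, mul_right_comm]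
  exact hbound.trans (le_mul_of_one_le_right (by positivity) hprod)

/-- The image of the open disc is open and, by the bound on the circle, relatively closed in the
connected ball `|v| < |c|`, so it contains that ball. Compactness then reaches `c` on its boundary.
-/
theorem mem_image_closedBall_of_norm_le {p : ℂ[X]} (hdeg : 0 < p.natDegree) {a c : ℂ} {r : ℝ}
    (hr : 0 < r) (hpa : p.IsRoot a) (hc0 : c ≠ 0)
    (hc : ∀ z ∈ Metric.sphere a r, ‖c‖ ≤ ‖p.eval z‖) :
    ∃ b ∈ Metric.closedBall a r, p.eval b = c := by
  have hopen : IsOpen ((fun z => p.eval z) '' Metric.ball a r) := by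
    rcases AnalyticOnNhd.is_constant_or_isOpen (g := fun z => p.eval z) (U := Set.univ)
      (fun z _ => p.differentiable.analyticAt z) isPreconnected_univ with ⟨w, hw⟩ | h
    · have hpC : p = C w := Polynomial.funext fun z => by simpa using hw z trivial
      rw [hpC, natDegree_C] at hdeg
      exact absurd hdeg (lt_irrefl 0)
    · exact h _ (Set.subset_univ _) Metric.isOpen_ball
  have hcpt : IsCompact ((fun z => p.eval z) '' Metric.closedBall a r) :=
    (isCompact_closedBall a r).image p.continuous
  have hsub : Metric.ball (0 : ℂ) ‖c‖ ⊆ (fun z => p.eval z) '' Metric.ball a r := by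
    refine (convex_ball (0 : ℂ) ‖c‖).isPreconnected.subset_of_closure_inter_subset hopen
      ⟨0, by simpa using hc0, a, Metric.mem_ball_self hr, hpa⟩ ?_
    rintro v ⟨hv, hvc⟩
    obtain ⟨z, hz, rfl⟩ := closure_minimal (Set.image_mono Metric.ball_subset_closedBall)
      hcpt.isClosed hv
    rcases (Metric.mem_closedBall.1 hz).lt_or_eq with h | h
    · exact ⟨z, h, rfl⟩
    · exact absurd (mem_ball_zero_iff.1 hvc) (hc z h).not_gt
  have hcl := closure_minimal (hsub.trans (Set.image_mono Metric.ball_subset_closedBall))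
    hcpt.isClosed
  rw [closure_ball _ (norm_ne_zero_iff.2 hc0)] at hcl
  obtain ⟨b, hb, hbc⟩ := hcl (show c ∈ Metric.closedBall (0 : ℂ) ‖c‖ by simp)
  exact ⟨b, hb, hbc⟩

theorem norm_le_one_of_derivative_isRoot {p : ℂ[X]} (hdeg : 0 < p.degree)
    (hzeros : ∀ z, p.IsRoot z → ‖z‖ ≤ 1) (hd : derivative p ≠ 0) {ζ : ℂ}
    (hζ : (derivative p).IsRoot ζ) : ‖ζ‖ ≤ 1 := by
  have hmem := rootSet_derivative_subset_convexHull_rootSet hdeg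
    (show ζ ∈ (derivative p).rootSet ℂ by
      rw [mem_rootSet, coe_aeval_eq_eval]; exact ⟨hd, hζ⟩)
  have := convexHull_min (fun z hz => by
    rw [mem_rootSet, coe_aeval_eq_eval] at hz
    exact mem_closedBall_zero_iff.2 (hzeros z hz.2)) (convex_closedBall (0 : ℂ) 1) hmem
  exact mem_closedBall_zero_iff.1 this

end Polynomial

/-! ### The main theorem. -/

theorem theorem1 (n : ℕ) (hn : 2 ≤ n) (p : Polynomial ℂ) (hmonic : p.Monic)
    (hdeg : p.natDegree = n)
    (hzeros : ∀ z : ℂ, p.IsRoot z → ‖z‖ ≤ 1)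
    (a : ℝ) (ha0 : 0 < a) (ha1 : a < 1) (hpa : p.IsRoot (a : ℂ))
    (hrho : ∀ ζ : ℂ, p.derivative.IsRoot ζ → 1 ≤ ‖(a : ℂ) - ζ‖)
    (lam : ℝ)
    (hlam_lower : 1 - (1 - ‖p.eval 0‖) ^ (1 / (n : ℝ)) ≤ lam)
    (hlam_upper : lam ≤ Real.sin (Real.pi / (n : ℝ)))
    (hlam_a : lam < a) :
    ∃ ζ₀ : ℂ, p.derivative.IsRoot ζ₀ ∧
      (1 / 2 : ℝ) * (a - lam * (lam + 2) / a) ≤ ζ₀.re := by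
  subst hdeg
  set n := p.natDegree with hndef
  have hn0 : n ≠ 0 := by omega
  have hp0 : ‖p.eval 0‖ ≤ 1 := by
    have h := (IsAlgClosed.splits p).coeff_zero_eq_leadingCoeff_mul_prod_roots
    rw [Polynomial.coeff_zero_eq_eval_zero, hmonic.leadingCoeff, mul_one] at h
    rw [h, norm_mul, norm_pow, norm_neg, norm_one, one_pow, one_mul]
    exact norm_multiset_prod_le_one fun z hz => hzeros z (Polynomial.isRoot_of_mem_roots hz)
  have hlam0 : 0 ≤ lam := by
    refine le_trans ?_ hlam_lower
    rw [sub_nonneg]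
    exact Real.rpow_le_one (by linarith) (by linarith [norm_nonneg (p.eval 0)]) (by positivity)
  have hc : ‖p.eval 0‖ ≤ 1 - (1 - lam) ^ n := by
    have h : (1 - lam) ^ n ≤ ((1 - ‖p.eval 0‖) ^ (1 / (n : ℝ))) ^ n :=
      pow_le_pow_left₀ (by linarith) (by linarith) n
    rw [one_div, Real.rpow_inv_natCast_pow (by linarith) hn0] at h
    linarith
  obtain ⟨b, hb, hpb⟩ : ∃ b ∈ Metric.closedBall (a : ℂ) lam, p.eval b = p.eval 0 := by
    -- Here `λ` may be `0`, leaving no disc to map; `b = a` serves.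
    by_cases h0 : p.eval 0 = 0
    · exact ⟨a, Metric.mem_closedBall_self hlam0, hpa.eq_zero.trans h0.symm⟩
    · have hlpos : 0 < lam := by
        refine hlam0.lt_of_ne fun h => h0 (norm_le_zero_iff.1 ?_)
        rw [← h] at hc
        simpa using hc
      refine p.mem_image_closedBall_of_norm_le (by omega) hlpos hpa h0 fun z hz => ?_
      have hz' : ‖z - a‖ = lam := by rwa [mem_sphere_iff_norm] at hz
      have := Polynomial.one_sub_one_sub_norm_pow_le_norm_eval hmonic hn hpa hrho (w := z - a)
        (by rw [hz']; exact hlam_upper)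
      rw [hz', add_sub_cancel] at this
      exact hc.trans this
  have hba : ‖b - a‖ ≤ lam := by rwa [mem_closedBall_iff_norm] at hb
  have hb0 : b ≠ 0 := by
    rintro rfl
    rw [zero_sub, norm_neg, Complex.norm_real, Real.norm_of_nonneg ha0.le] at hba
    linarith
  obtain ⟨ζ, hζ, hle⟩ := Polynomial.exists_derivative_isRoot_norm_sub_le hmonic hb0 hpb
  refine ⟨ζ, hζ, ?_⟩
  have hζ1 : ‖ζ‖ ≤ 1 := by
    refine Polynomial.norm_le_one_of_derivative_isRoot
      (Polynomial.natDegree_pos_iff_degree_pos.1 (by omega)) hzeros (fun h => ?_) hζ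
    have := Polynomial.derivative_eq_zero.1 h
    omega
  have htri : ‖ζ - a‖ ≤ ‖ζ‖ + lam := by
    calc ‖ζ - a‖ = ‖(ζ - b) + (b - a)‖ := by rw [sub_add_sub_cancel]
      _ ≤ ‖ζ - b‖ + ‖b - a‖ := norm_add_le _ _
      _ ≤ ‖ζ‖ + lam := add_le_add hle hba
  have hsq : ‖ζ - a‖ ^ 2 ≤ (‖ζ‖ + lam) ^ 2 := by gcongr
  have h1 := Complex.norm_sq_eq_re_im (ζ - a)
  have h2 := Complex.norm_sq_eq_re_im ζ
  simp only [Complex.sub_re, Complex.sub_im, Complex.ofReal_re, Complex.ofReal_im, sub_zero] at h1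
  have hmul : lam * ‖ζ‖ ≤ lam := mul_le_of_le_one_right hlam0 hζ1
  -- `|ζ - a|² - |ζ|² = a² - 2a Re ζ` is at most `2λ|ζ| + λ²`.
  have hkey : a ^ 2 - lam * (lam + 2) ≤ 2 * a * ζ.re := by nlinarith
  rw [show (1 / 2 : ℝ) * (a - lam * (lam + 2) / a) = (a ^ 2 - lam * (lam + 2)) / (2 * a) by
    field_simp, div_le_iff₀ (by linarith)]
  linarith
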